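/- Let $d\ge 2$ be an integer and let $\tau$ be a real number with $1/d<\tau\le 1$. Let $\mathrm{Diff}^{1+\tau}_+([0,1])$ denote the group of orientation-preserving $C^1$ diffeomorphisms $f$ of the closed interval $[0,1]$ whose derivative is $\tau$-Hölder continuous on $[0,1]$, that is, for which there is a constant $C<\infty$ with $|f'(x)-f'(y)|\le C|x-y|^{\tau}$ for all $x,y\in[0,1]$ (for $\tau=1$: $f'$ is Lipschitz). Let $\Gamma$ be a subgroup of $\mathrm{Diff}^{1+\tau}_+([0,1])$ isomorphic to $\mathbb{Z}^d$ whose action on the open interval $]0,1[$ is free, that is, no element of $\Gamma$ other than the identity has a fixed point in $]0,1[$. Then the action of $\Gamma$ on $]0,1[$ is minimal, that is, the $\Gamma$-orbit of every point of $]0,1[$ is dense in $]0,1[$; moreover, it is topologically conjugate to an action by translations of the real line, that is, there are a homeomorphism $\varphi:\;]0,1[\;\to\mathbb{R}$ and a group homomorphism $T:\Gamma\to(\mathbb{R},+)$ such that $\varphi(g(x))=\varphi(x)+T(g)$ for all $g\in\Gamma$ and all $x\in\;]0,1[$. -/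

import Mathlib

open scoped unitInterval

/-- `Homeo₊([0,1])`: the group (under composition) of orientation-preserving homeomorphisms
of `[0,1]`. -/
def HomeoPlus : Subgroup (I ≃ₜ I) where
  carrier := {f | StrictMono f}
  one_mem' := strictMono_id
  mul_mem' := fun {_ _} hf hg => hf.comp hg
  inv_mem' := by
    intro f hf x y hxy
    by_contra h
    have h' : f (f.symm y) ≤ f (f.symm x) := hf.monotone (not_lt.mp h)
    simp only [Homeomorph.apply_symm_apply] at h'
    exact absurd hxy (not_lt.mpr h')

namespace HomeoPlus

theorem map_zero (f : HomeoPlus) : f.1 0 = 0 := by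
  apply le_antisymm _ unitInterval.nonneg'
  have h : f.1 0 ≤ f.1 (f.1.symm 0) := f.2.monotone unitInterval.nonneg'
  simpa using h

theorem map_one (f : HomeoPlus) : f.1 1 = 1 := by
  apply le_antisymm unitInterval.le_one'
  have h : f.1 (f.1.symm 1) ≤ f.1 1 := f.2.monotone unitInterval.le_one'
  simpa using h

theorem map_mem_Ioo (f : HomeoPlus) {x : I} (hx : x ∈ Set.Ioo (0 : I) 1) :
    f.1 x ∈ Set.Ioo (0 : I) 1 :=
  ⟨(map_zero f).symm.trans_lt (f.2 hx.1), (f.2 hx.2).trans_eq (map_one f)⟩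

/-- Orientation-preserving homeomorphisms of `[0,1]` fix the endpoints; this is the restriction
of their action to the open interval `]0,1[`. -/
instance : MulAction HomeoPlus (Set.Ioo (0 : I) 1) where
  smul f x := ⟨f.1 x.1, map_mem_Ioo f x.2⟩
  one_smul _ := rfl
  mul_smul _ _ _ := rfl

/-- A homeomorphism of `[0,1]` as a real function: it is `f` on `[0,1]` (and is extended by
constants outside `[0,1]`, where its values are never used). -/
noncomputable def toReal (f : HomeoPlus) : ℝ → ℝ :=
  Set.IccExtend (zero_le_one (α := ℝ)) (fun x : I => (f.1 x : ℝ))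

/-- `f ∈ Diff₊^{1+τ}([0,1])`: `f` is an orientation-preserving `C¹` diffeomorphism of `[0,1]`
(`f` and `f⁻¹` are `C¹` on the closed interval, with one-sided derivatives at the endpoints),
and its derivative is `τ`-Hölder continuous on `[0,1]`. -/
structure IsDiffeoHolder (τ : ℝ) (f : HomeoPlus) : Prop where
  contDiffOn : ContDiffOn ℝ 1 (toReal f) (Set.Icc 0 1)
  contDiffOn_inv : ContDiffOn ℝ 1 (toReal f⁻¹) (Set.Icc 0 1)
  holder : ∃ C : ℝ, ∀ x ∈ Set.Icc (0 : ℝ) 1, ∀ y ∈ Set.Icc (0 : ℝ) 1,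
    |derivWithin (toReal f) (Set.Icc 0 1) x - derivWithin (toReal f) (Set.Icc 0 1) y|
      ≤ C * |x - y| ^ τ

/-- The action of `Γ` on `]0,1[` is free. -/
def ActsFreely (Γ : Subgroup HomeoPlus) : Prop :=
  ∀ g : Γ, ∀ x : Set.Ioo (0 : I) 1, g • x = x → g = 1

/-- The action of `Γ` on `]0,1[` is topologically conjugate, by a homeomorphism
`φ : ]0,1[ → ℝ`, to an action of `Γ` on `ℝ` by translations `y ↦ y + T g`. -/
def ConjugateToTranslations (Γ : Subgroup HomeoPlus) : Prop :=
  ∃ (φ : Set.Ioo (0 : I) 1 ≃ₜ ℝ) (T : Γ →* Multiplicative ℝ),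
    ∀ (g : Γ) (x : Set.Ioo (0 : I) 1), φ (g • x) = φ x + (T g).toAdd

end HomeoPlus

/-! By Hölder's argument, a free action of a commutative group by increasing bijections embeds the
group in the real line through translation numbers (`exists_translationHom`); since the rank is at
least two, the image is dense. A minimal action is then conjugate to the translations
(`exists_homeomorph_translation`), so the point is to prove minimality.

If minimality fails, `exists_wandering_interval` gives an interval `[x, b]` with non-overlapping
images and `b` accumulated by them on the right. The lengths of the images are indexed by `ℤᵈ` and
have sum at most one. Averaging over walks in dyadic cubes, `exists_uniform_hasWalk` reaches every
lattice point from the origin along a walk whose sum of `τ`-th powers of lengths is bounded by a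
uniform constant; this is where `τ > 1 / d` enters. By Hölder distortion (`exists_distortion_le`,
`HasWalk.ratio_le`), a short interval `[b, b']` next to `[x, b]` then stays no longer than its
neighbour under every group element. An element that moves points to the right and sends `[x, b]`
just to the right of `b` would thus map `b'` to at most `b'`, a contradiction
(`false_of_wandering_interval`). -/

section OrderedDynamics

/-! ### Free actions on ordered spaces: translation numbers, minimality, conjugacy. -/

variable {G X : Type*} [Group G] [MulAction G X]

theorem smul_lt_smul_iff_of_strictMono [LinearOrder X] (hmono : ∀ g : G, StrictMono fun x : X => g • x)
    (g : G) {x y : X} : g • x < g • y ↔ x < y :=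
  (hmono g).lt_iff_lt

theorem smul_le_smul_iff_of_strictMono [LinearOrder X] (hmono : ∀ g : G, StrictMono fun x : X => g • x)
    (g : G) {x y : X} : g • x ≤ g • y ↔ x ≤ y :=
  (hmono g).le_iff_le

theorem continuous_smul_of_strictMono [LinearOrder X] [TopologicalSpace X] [OrderTopology X]
    (hmono : ∀ g : G, StrictMono fun x : X => g • x) (g : G) : Continuous fun x : X => g • x :=
  (StrictMono.orderIsoOfSurjective _ (hmono g) (MulAction.surjective g)).continuous

variable [ConditionallyCompleteLinearOrder X]

/-- An element without fixed points moves all points in the same direction. -/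
theorem lt_smul_of_lt_smul [DenselyOrdered X] (hmono : ∀ g : G, StrictMono fun x : X => g • x)
    (hfree : ∀ (g : G) (x : X), g • x = x → g = 1) {g : G} {x : X} (h : x < g • x) (y : X) :
    y < g • y := by
  let _ : TopologicalSpace X := Preorder.topology X
  have : OrderTopology X := ⟨rfl⟩
  by_contra! hy
  obtain ⟨z, -, hz⟩ := isPreconnected_univ.intermediate_value₂ (Set.mem_univ y) (Set.mem_univ x)
    (continuous_smul_of_strictMono hmono g).continuousOn continuousOn_id hy h.le
  rw [hfree g z hz, one_smul] at h
  exact h.false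

/-- The supremum `s` of a bounded forward orbit satisfies `g⁻¹ • s < s`, so some orbit point exceeds
`g⁻¹ • s` and the next one exceeds `s`. -/
theorem exists_lt_pow_smul (hmono : ∀ g : G, StrictMono fun x : X => g • x) {g : G}
    (hg : ∀ x : X, x < g • x) (y z : X) : ∃ n : ℕ, z < g ^ n • y := by
  by_contra! h
  have hb : BddAbove (Set.range fun n : ℕ => g ^ n • y) := ⟨z, by rintro _ ⟨n, rfl⟩; exact h n⟩
  set s := sSup (Set.range fun n : ℕ => g ^ n • y)
  have hs : g⁻¹ • s < s := by
    rw [← smul_lt_smul_iff_of_strictMono hmono g, smul_inv_smul]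
    exact hg s
  obtain ⟨_, ⟨n, rfl⟩, hn⟩ := exists_lt_of_lt_csSup (Set.range_nonempty _) hs
  rw [← smul_lt_smul_iff_of_strictMono hmono g, smul_inv_smul, smul_smul, ← pow_succ'] at hn
  exact absurd (le_csSup hb ⟨n + 1, rfl⟩) (not_le.mpr hn)

/-- Hölder's theorem: a commutative group acting freely by increasing bijections has an
injective translation number homomorphism to the real line. -/
theorem exists_translationHom [DenselyOrdered X] [Nonempty X] (hcomm : ∀ g h : G, g * h = h * g)
    (hmono : ∀ g : G, StrictMono fun x : X => g • x)
    (hfree : ∀ (g : G) (x : X), g • x = x → g = 1) :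
    ∃ T : G →* Multiplicative ℝ, ∀ (g : G) (x : X), x < g • x ↔ 0 < (T g).toAdd := by
  obtain ⟨x₀⟩ := ‹Nonempty X›
  let _ : CommGroup G := { ‹Group G› with mul_comm := hcomm }
  have hinj : Function.Injective fun g : Additive G => g.toMul • x₀ := by
    intro g h hgh
    have : (h.toMul⁻¹ * g.toMul) • x₀ = x₀ := by
      rw [mul_smul, inv_smul_eq_iff]
      exact hgh
    exact (inv_mul_eq_one.mp (hfree _ _ this)).symm
  -- The group is ordered by the position of its elements on the orbit of `x₀`; this order is
  -- Archimedean, hence embeds in `ℝ`.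
  let _ : LinearOrder (Additive G) := LinearOrder.lift' _ hinj
  have hle : ∀ g h : Additive G, g ≤ h ↔ g.toMul • x₀ ≤ h.toMul • x₀ := fun _ _ => Iff.rfl
  have hlt : ∀ g h : Additive G, g < h ↔ g.toMul • x₀ < h.toMul • x₀ := fun _ _ => Iff.rfl
  have : IsOrderedAddMonoid (Additive G) :=
    { add_le_add_left := by
        intro a b hab c
        rw [add_comm a, add_comm b, hle, toMul_add, toMul_add, mul_smul, mul_smul]
        exact (hmono _).monotone hab }
  have : Archimedean (Additive G) := ⟨fun a b hb => by
    have hb' : x₀ < b.toMul • x₀ := by simpa [hlt] using hb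
    obtain ⟨n, hn⟩ := exists_lt_pow_smul hmono (lt_smul_of_lt_smul hmono hfree hb') x₀
      (a.toMul • x₀)
    exact ⟨n, hn.le⟩⟩
  obtain ⟨f, hf⟩ := Archimedean.exists_orderAddMonoidHom_real_injective (Additive G)
  have hfm : StrictMono f := f.monotone'.strictMono_of_injective hf
  refine ⟨AddMonoidHom.toMultiplicativeRight (f : Additive G →+ ℝ), fun g x => ?_⟩
  have h1 : x < g • x ↔ x₀ < g • x₀ :=
    ⟨fun h => lt_smul_of_lt_smul hmono hfree h _, fun h => lt_smul_of_lt_smul hmono hfree h _⟩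
  have h2 : (0 : Additive G) < Additive.ofMul g ↔ x₀ < g • x₀ := by simp [hlt]
  rw [h1, ← h2, ← hfm.lt_iff_lt, map_zero]
  rfl

variable {T : G →* Multiplicative ℝ}

theorem smul_lt_smul_iff_translation (hT : ∀ (g : G) (x : X), x < g • x ↔ 0 < (T g).toAdd)
    (hmono : ∀ g : G, StrictMono fun x : X => g • x) {g h : G} (x : X) :
    g • x < h • x ↔ (T g).toAdd < (T h).toAdd := by
  rw [← smul_lt_smul_iff_of_strictMono hmono g⁻¹, inv_smul_smul, smul_smul, hT, map_mul, map_inv,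
    toAdd_mul, toAdd_inv, neg_add_eq_sub, sub_pos]

theorem eq_one_of_translation_eq_zero (hT : ∀ (g : G) (x : X), x < g • x ↔ 0 < (T g).toAdd)
    (hmono : ∀ g : G, StrictMono fun x : X => g • x)
    (hfree : ∀ (g : G) (x : X), g • x = x → g = 1) [Nonempty X] {g : G} (hg : (T g).toAdd = 0) :
    g = 1 := by
  obtain ⟨x⟩ := ‹Nonempty X›
  have h1 := smul_lt_smul_iff_translation hT hmono (g := g) (h := 1) x
  have h2 := smul_lt_smul_iff_translation hT hmono (g := 1) (h := g) x
  simp only [one_smul, map_one, toAdd_one, hg, lt_irrefl, iff_false, not_lt] at h1 h2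
  exact hfree g x (le_antisymm h2 h1)

theorem exists_translation_mem_Ioo (hdense : DenseRange fun g => (T g).toAdd) {r s : ℝ}
    (hrs : r < s) : ∃ g, r < (T g).toAdd ∧ (T g).toAdd < s :=
  hdense.exists_mem_open isOpen_Ioo (Set.nonempty_Ioo.mpr hrs)

/-- If points have images arbitrarily close to them on the right, then all orbits are dense. -/
theorem isMinimal_of_exists_smul_lt [Nontrivial X] [DenselyOrdered X] [TopologicalSpace X]
    [OrderTopology X] (hT : ∀ (g : G) (x : X), x < g • x ↔ 0 < (T g).toAdd)
    (hmono : ∀ g : G, StrictMono fun x : X => g • x)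
    (h : ∀ x q : X, x < q → ∃ g : G, 0 < (T g).toAdd ∧ g • x < q) : MulAction.IsMinimal G X := by
  refine ⟨fun y => dense_of_exists_between fun p q hpq => ?_⟩
  obtain ⟨g, hg, hgq⟩ := h p q hpq
  have hg' : ∀ x : X, x < g • x := fun x => (hT g x).mpr hg
  obtain ⟨k, hk⟩ := exists_lt_pow_smul hmono hg' p y
  set z := (g ^ k)⁻¹ • y with hz
  have hzp : z < p := by
    rw [hz, ← smul_lt_smul_iff_of_strictMono hmono (g ^ k), smul_inv_smul]
    exact hk
  -- The first iterate of `z` beyond `p` has its predecessor at most `p`, so it lies at most at `g •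
  -- p < q`.
  have hex := exists_lt_pow_smul hmono hg' z p
  classical
  have h1 := Nat.find_spec hex
  have h2 : Nat.find hex ≠ 0 := by
    intro h0
    rw [h0, pow_zero, one_smul] at h1
    exact (h1.trans hzp).false
  obtain ⟨m, hm⟩ := Nat.exists_eq_succ_of_ne_zero h2
  have h3 : g ^ m • z ≤ p := not_lt.mp (Nat.find_min hex (m := m) (by omega))
  refine ⟨g ^ Nat.find hex • z, ?_, h1, ?_⟩
  · exact ⟨g ^ Nat.find hex * (g ^ k)⁻¹, mul_smul _ _ _⟩
  · rw [hm, Nat.succ_eq_add_one, pow_succ', mul_smul]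
    exact ((hmono g).monotone h3).trans_lt hgq

/-- If some point is isolated from its images on the right, then there is an interval `[x, b]`
whose images do not overlap, and whose right endpoint is accumulated by them. -/
theorem exists_wandering_interval
    (hmono : ∀ g : G, StrictMono fun x : X => g • x) (hdense : DenseRange fun g => (T g).toAdd)
    {x q : X} (hxq : x < q) (h : ∀ g : G, 0 < (T g).toAdd → q ≤ g • x) :
    ∃ b : X, x < b ∧ (∀ g : G, 0 < (T g).toAdd → b ≤ g • x) ∧
      ∀ r, b < r → ∃ g : G, 0 < (T g).toAdd ∧ g • b < r := by
  set A : Set X := (fun g : G => g • x) '' {g | 0 < (T g).toAdd}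
  have hne : A.Nonempty := by
    obtain ⟨g, hg, -⟩ := exists_translation_mem_Ioo hdense zero_lt_one
    exact ⟨_, g, hg, rfl⟩
  have hlb : q ∈ lowerBounds A := by
    rintro _ ⟨g, hg, rfl⟩
    exact h g hg
  have hb : ∀ g : G, 0 < (T g).toAdd → sInf A ≤ g • x := fun g hg => csInf_le ⟨q, hlb⟩ ⟨g, hg, rfl⟩
  refine ⟨sInf A, hxq.trans_le (le_csInf hne hlb), hb, fun r hr => ?_⟩
  obtain ⟨_, ⟨v, hv, rfl⟩, hvr⟩ := exists_lt_of_csInf_lt hne hr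
  -- Split `v` as `u * (u⁻¹ * v)` with both factors positive: the second moves `x` to at least `b`,
  -- so `u • b ≤ v • x < r`.
  obtain ⟨u, hu, huv⟩ := exists_translation_mem_Ioo hdense (show 0 < (T v).toAdd from hv)
  refine ⟨u, hu, lt_of_le_of_lt ?_ hvr⟩
  have h1 := hb (u⁻¹ * v) (by rw [map_mul, map_inv, toAdd_mul, toAdd_inv]; linarith)
  rw [← smul_le_smul_iff_of_strictMono hmono u, smul_smul, mul_inv_cancel_left] at h1
  exact h1

/-- A minimal action with translation numbers is conjugate to an action by translations. -/
theorem exists_homeomorph_translation [Nonempty X] [DenselyOrdered X] [TopologicalSpace X]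
    [OrderTopology X] (hT : ∀ (g : G) (x : X), x < g • x ↔ 0 < (T g).toAdd)
    (hmono : ∀ g : G, StrictMono fun x : X => g • x) (hdense : DenseRange fun g => (T g).toAdd)
    (hmin : MulAction.IsMinimal G X) :
    ∃ φ : X ≃ₜ ℝ, ∀ (g : G) (x : X), φ (g • x) = φ x + (T g).toAdd := by
  obtain ⟨x₀⟩ := ‹Nonempty X›
  have hlt : ∀ g h : G, g • x₀ < h • x₀ ↔ (T g).toAdd < (T h).toAdd := fun g h =>
    smul_lt_smul_iff_translation hT hmono x₀
  have hle : ∀ g h : G, g • x₀ ≤ h • x₀ ↔ (T g).toAdd ≤ (T h).toAdd := fun g h => by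
    rw [← not_lt, hlt, not_lt]
  -- Dedekind cuts: the conjugacy extends `h • x₀ ↦ T h` from the dense orbit of `x₀` by suprema.
  set A : X → Set ℝ := fun x => (fun g : G => (T g).toAdd) '' {g | g • x₀ ≤ x} with hA
  obtain ⟨e, he, -⟩ := exists_translation_mem_Ioo hdense (zero_lt_one (α := ℝ))
  have he' : ∀ x : X, x < e • x := fun x => (hT e x).mpr he
  have hne : ∀ x, (A x).Nonempty := fun x => by
    obtain ⟨n, hn⟩ := exists_lt_pow_smul hmono he' x x₀
    refine ⟨_, (e ^ n)⁻¹, ?_, rfl⟩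
    rw [Set.mem_ofPred, ← smul_le_smul_iff_of_strictMono hmono (e ^ n), smul_inv_smul]
    exact hn.le
  have hub : ∀ (x : X) (h : G), x ≤ h • x₀ → (T h).toAdd ∈ upperBounds (A x) := by
    rintro x h hx _ ⟨g, hg, rfl⟩
    exact (hle g h).mp (hg.trans hx)
  have hbdd : ∀ x, BddAbove (A x) := fun x => by
    obtain ⟨n, hn⟩ := exists_lt_pow_smul hmono he' x₀ x
    exact ⟨_, hub x _ hn.le⟩
  set φ : X → ℝ := fun x => sSup (A x) with hφ
  have hφ_le : ∀ (x : X) (h : G), x ≤ h • x₀ → φ x ≤ (T h).toAdd := fun x h hx =>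
    csSup_le (hne x) (hub x h hx)
  have hle_φ : ∀ (x : X) (h : G), h • x₀ ≤ x → (T h).toAdd ≤ φ x := fun x h hx =>
    le_csSup (hbdd x) ⟨h, hx, rfl⟩
  have hφ₀ : ∀ h : G, φ (h • x₀) = (T h).toAdd := fun h =>
    le_antisymm (hφ_le _ _ le_rfl) (hle_φ _ _ le_rfl)
  have horb : ∀ x y : X, x < y → ∃ g : G, x < g • x₀ ∧ g • x₀ < y := fun x y hxy => by
    obtain ⟨_, ⟨g, rfl⟩, h⟩ := (hmin.dense_orbit x₀).exists_between hxy
    exact ⟨g, h⟩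
  have hsm : StrictMono φ := by
    intro x y hxy
    obtain ⟨g, h1, h2⟩ := horb x y hxy
    obtain ⟨h, h3, h4⟩ := horb _ _ h2
    calc φ x ≤ (T g).toAdd := hφ_le _ _ h1.le
      _ < (T h).toAdd := (hlt g h).mp h3
      _ ≤ φ y := hle_φ _ _ h4.le
  have hcont : Continuous φ := by
    refine hsm.monotone.continuous_of_denseRange (hdense.mono ?_)
    rintro _ ⟨g, rfl⟩
    exact ⟨g • x₀, hφ₀ g⟩
  have hsurj : Function.Surjective φ := by
    intro r
    refine mem_range_of_exists_le_of_exists_ge hcont ?_ ?_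
    · obtain ⟨g, -, hg⟩ := exists_translation_mem_Ioo hdense (sub_one_lt r)
      exact ⟨g • x₀, by rw [hφ₀]; exact hg.le⟩
    · obtain ⟨g, hg, -⟩ := exists_translation_mem_Ioo hdense (lt_add_one r)
      exact ⟨g • x₀, by rw [hφ₀]; exact hg.le⟩
  refine ⟨(hsm.orderIsoOfSurjective φ hsurj).toHomeomorph, fun g x => ?_⟩
  change φ (g • x) = φ x + (T g).toAdd
  have hcl : IsClosed {x : X | φ (g • x) = φ x + (T g).toAdd} :=
    isClosed_eq (hcont.comp (continuous_smul_of_strictMono hmono g)) (hcont.add continuous_const)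
  have hsub : MulAction.orbit G x₀ ⊆ {x : X | φ (g • x) = φ x + (T g).toAdd} := by
    rintro _ ⟨h, rfl⟩
    change φ (g • h • x₀) = φ (h • x₀) + (T g).toAdd
    rw [smul_smul, hφ₀, hφ₀, map_mul, toAdd_mul, add_comm]
  exact hcl.closure_subset_iff.mpr hsub (hmin.dense_orbit x₀ x)

end OrderedDynamics

/-! ### Density of the translation numbers. -/

/-- An injective homomorphism to the real line from a free abelian group of rank at least two
has dense range. -/
theorem denseRange_of_mulEquiv_int_pi {G : Type*} [Group G] {d : ℕ} (hd : 2 ≤ d)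
    (e : G ≃* Multiplicative (Fin d → ℤ)) (T : G →* Multiplicative ℝ)
    (hT : ∀ g, (T g).toAdd = 0 → g = 1) : DenseRange fun g => (T g).toAdd := by
  set f : (Fin d → ℤ) →+ ℝ := AddMonoidHom.mk' (fun v => (T (e.symm (.ofAdd v))).toAdd) fun v w => by
    rw [ofAdd_add, map_mul, map_mul, toAdd_mul] with hf
  have hinj : ∀ v, f v = 0 → v = 0 := fun v hv => by
    simpa using hT _ hv
  have hrange : (f.range : Set ℝ) = Set.range fun g => (T g).toAdd := by
    ext r
    constructor
    · rintro ⟨v, rfl⟩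
      exact ⟨_, rfl⟩
    · rintro ⟨g, rfl⟩
      exact ⟨(e g).toAdd, by simp [hf]⟩
  rw [DenseRange, ← hrange]
  refine f.range.dense_or_cyclic.resolve_right ?_
  rintro ⟨a, ha⟩
  have hmem : ∀ v, ∃ n : ℤ, n • a = f v := fun v => by
    rw [← AddSubgroup.mem_closure_singleton, ← ha]
    exact ⟨v, rfl⟩
  let i : Fin d := ⟨0, by omega⟩
  let j : Fin d := ⟨1, by omega⟩
  have hij : i ≠ j := by simp [i, j]
  obtain ⟨n, hn⟩ := hmem (Pi.single i 1)
  obtain ⟨m, hm⟩ := hmem (Pi.single j 1)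
  -- In a cyclic range the images of two basis vectors satisfy an integer relation, which
  -- injectivity lifts to `ℤᵈ`.
  have h0 : m • (Pi.single i 1 : Fin d → ℤ) - n • Pi.single j 1 = 0 := by
    refine hinj _ ?_
    rw [map_sub, map_zsmul, map_zsmul, ← hn, ← hm, smul_comm, sub_self]
  have hnj : n = 0 := by simpa [hij, hij.symm] using congrFun h0 j
  rw [hnj, zero_smul] at hn
  simpa using congrFun (hinj _ hn.symm) i

/-! ### Walks of uniformly bounded cost in `ℤᵈ`. -/

section LatticeWalks

variable {d : ℕ}

/-- Two points of `ℤᵈ` are adjacent if they differ by a vector of the canonical basis. -/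
def LatticeAdj (y z : Fin d → ℤ) : Prop :=
  ∃ i, z = y + Pi.single i 1 ∨ y = z + Pi.single i 1

theorem LatticeAdj.symm {y z : Fin d → ℤ} (h : LatticeAdj y z) : LatticeAdj z y := by
  obtain ⟨i, hi⟩ := h
  exact ⟨i, hi.symm⟩

/-- `HasWalk w x y c`: there is a nearest neighbour walk from `x` to `y` in `ℤᵈ` of cost at
most `c`, where a step from `y` to `z` costs `w y + w z`. -/
inductive HasWalk (w : (Fin d → ℤ) → ℝ) (x : Fin d → ℤ) : (Fin d → ℤ) → ℝ → Prop
  | refl {c : ℝ} : 0 ≤ c → HasWalk w x x c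
  | step {y z : Fin d → ℤ} {c c' : ℝ} :
      HasWalk w x y c → LatticeAdj y z → c + (w y + w z) ≤ c' → HasWalk w x z c'

namespace HasWalk

variable {w : (Fin d → ℤ) → ℝ} {x y z : Fin d → ℤ} {a b c : ℝ}

theorem mono (h : HasWalk w x y a) (hab : a ≤ b) : HasWalk w x y b := by
  cases h with
  | refl h0 => exact refl (h0.trans hab)
  | step h hyz hc => exact step h hyz (hc.trans hab)

theorem trans (h₁ : HasWalk w x y a) (h₂ : HasWalk w y z b) : HasWalk w x z (a + b) := by
  induction h₂ with
  | refl h0 => exact h₁.mono (by linarith)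
  | step _ hyz hc ih => exact step ih hyz (by linarith)

/-- Each step is charged for both endpoints, so its cost does not depend on its direction. -/
theorem symm (h : HasWalk w x y a) : HasWalk w y x a := by
  induction h with
  | refl h0 => exact refl h0
  | @step y z c c' _ hyz hc ih =>
    have h1 : HasWalk w z y (w z + w y) := step (refl le_rfl) hyz.symm (by linarith)
    exact (h1.trans ih).mono (by linarith)

theorem sum_fin : ∀ {n : ℕ} (h : Fin (n + 1) → Fin d → ℤ) (c : Fin n → ℝ),
    (∀ k : Fin n, HasWalk w (h k.castSucc) (h k.succ) (c k)) →
    HasWalk w (h 0) (h (Fin.last n)) (∑ k, c k)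
  | 0, _, _, _ => refl (by simp)
  | n + 1, h, c, H => by
    rw [Fin.sum_univ_castSucc]
    exact (sum_fin (fun k => h k.castSucc) (fun k => c k.castSucc) fun k => H k.castSucc).trans
      (H (Fin.last n))

theorem update_add (p : Fin d → ℤ) (j : Fin d) (s : ℤ) (n : ℕ) :
    HasWalk w (Function.update p j s) (Function.update p j (s + n))
      (∑ i ∈ Finset.range n,
        (w (Function.update p j (s + i)) + w (Function.update p j (s + (i + 1 : ℕ))))) := by
  induction n with
  | zero => simpa using refl (w := w) (x := Function.update p j s) le_rfl
  | succ n ih =>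
    rw [Finset.sum_range_succ]
    refine step ih ⟨j, Or.inl ?_⟩ le_rfl
    ext i
    rcases eq_or_ne i j with rfl | hij
    · simp [add_assoc]
    · simp [hij]

theorem sum_range_add_le {F : ℤ → ℝ} (hF : ∀ u, 0 ≤ F u) {a b s : ℤ} {n : ℕ} (has : a ≤ s)
    (hsb : s + n ≤ b) : ∑ i ∈ Finset.range n, F (s + i) ≤ ∑ u ∈ Finset.Ico a b, F u := by
  rw [← Finset.sum_image (f := F) (g := fun i : ℕ => s + (i : ℤ)) (by intro i _ j _ h; simpa using h)]
  refine Finset.sum_le_sum_of_subset_of_nonneg (fun u hu => ?_) fun u _ _ => hF u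
  simp only [Finset.mem_image, Finset.mem_range] at hu
  obtain ⟨i, hi, rfl⟩ := hu
  rw [Finset.mem_Ico]
  omega

/-- Any two points of a segment parallel to a coordinate axis are joined along the segment. -/
theorem segment (hw : ∀ x, 0 ≤ w x) (p : Fin d → ℤ) (j : Fin d) {a b s t : ℤ}
    (hs : s ∈ Finset.Ico a b) (ht : t ∈ Finset.Ico a b) :
    HasWalk w (Function.update p j s) (Function.update p j t)
      (∑ u ∈ Finset.Ico a b, 2 * w (Function.update p j u)) := by
  rw [Finset.mem_Ico] at hs ht
  wlog hst : s ≤ t generalizing s t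
  · exact (this ht hs (le_of_not_ge hst)).symm
  obtain ⟨n, rfl⟩ := Int.le.dest hst
  -- Left and right endpoints of the steps each contribute at most the sum over the whole segment,
  -- hence the factor 2.
  refine (update_add p j s n).mono ?_
  have hF : ∀ u, 0 ≤ w (Function.update p j u) := fun u => hw _
  have h1 := sum_range_add_le hF (a := a) (b := b) (s := s) (n := n) hs.1 ht.2.le
  have h2 := sum_range_add_le hF (a := a) (b := b) (s := s + 1) (n := n) (by omega) (by omega)
  rw [Finset.sum_add_distrib, ← Finset.mul_sum]
  have h3 : ∑ i ∈ Finset.range n, w (Function.update p j (s + (i + 1 : ℕ)))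
      = ∑ i ∈ Finset.range n, w (Function.update p j (s + 1 + i)) := by
    refine Finset.sum_congr rfl fun i _ => ?_
    rw [Nat.cast_succ, add_assoc, add_comm (1 : ℤ)]
  rw [h3]
  linarith

end HasWalk

/-- The cube of side `N` with lowest corner `a`. -/
noncomputable def latticeBox (a : Fin d → ℤ) (N : ℕ) : Finset (Fin d → ℤ) :=
  Fintype.piFinset fun i => Finset.Ico (a i) (a i + N)

theorem mem_latticeBox {a p : Fin d → ℤ} {N : ℕ} :
    p ∈ latticeBox a N ↔ ∀ i, p i ∈ Finset.Ico (a i) (a i + N) :=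
  Fintype.mem_piFinset

theorem card_latticeBox (a : Fin d → ℤ) (N : ℕ) : (latticeBox a N).card = N ^ d := by
  simp [latticeBox, Fintype.card_piFinset]

/-- The point with the first `k` coordinates of `q` and the other coordinates of `p`. -/
def hybridPoint (k : ℕ) (p q : Fin d → ℤ) : Fin d → ℤ :=
  fun i => if i.val < k then q i else p i

theorem hybridPoint_mem_latticeBox {a p q : Fin d → ℤ} {N : ℕ} (k : ℕ) (hp : p ∈ latticeBox a N)
    (hq : q ∈ latticeBox a N) : hybridPoint k p q ∈ latticeBox a N := by
  rw [mem_latticeBox] at *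
  intro i
  unfold hybridPoint
  split_ifs
  exacts [hq i, hp i]

theorem hybridPoint_hybridPoint (k : ℕ) (p q : Fin d → ℤ) :
    hybridPoint k (hybridPoint k p q) (hybridPoint k q p) = p := by
  ext i
  simp only [hybridPoint]
  split_ifs <;> rfl

/-- The cost of the walks from `p` to `q` which change the coordinates one after the other
inside a cube. -/
noncomputable def boxCost (w : (Fin d → ℤ) → ℝ) (a : Fin d → ℤ) (N : ℕ) (p q : Fin d → ℤ) : ℝ :=
  ∑ k : Fin d, ∑ u ∈ Finset.Ico (a k) (a k + N), 2 * w (Function.update (hybridPoint k p q) k u)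

theorem boxCost_nonneg {w : (Fin d → ℤ) → ℝ} (hw : ∀ x, 0 ≤ w x) (a : Fin d → ℤ) (N : ℕ)
    (p q : Fin d → ℤ) : 0 ≤ boxCost w a N p q :=
  Finset.sum_nonneg fun _ _ => Finset.sum_nonneg fun _ _ => mul_nonneg zero_le_two (hw _)

theorem hasWalk_boxCost {w : (Fin d → ℤ) → ℝ} (hw : ∀ x, 0 ≤ w x) {a p q : Fin d → ℤ} {N : ℕ}
    (hp : p ∈ latticeBox a N) (hq : q ∈ latticeBox a N) : HasWalk w p q (boxCost w a N p q) := by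
  have h0 : hybridPoint 0 p q = p := by ext i; simp [hybridPoint]
  have hd : hybridPoint d p q = q := by ext i; simp [hybridPoint]
  -- Consecutive hybrid points differ only in coordinate `k`, so a segment joins them.
  have key := HasWalk.sum_fin (w := w) (fun k : Fin (d + 1) => hybridPoint k p q)
    (fun k : Fin d => ∑ u ∈ Finset.Ico (a k) (a k + N),
      2 * w (Function.update (hybridPoint k p q) k u)) fun k => ?_
  · simpa only [Fin.val_zero, Fin.val_last, h0, hd, boxCost] using key
  · rw [mem_latticeBox] at hp hq
    convert HasWalk.segment hw (hybridPoint k p q) k (hp k) (hq k) using 1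
    · ext i
      rcases eq_or_ne i k with rfl | hik
      · simp [hybridPoint]
      · simp [hik]
    · ext i
      rcases eq_or_ne i k with rfl | hik
      · simp [hybridPoint]
      · have : i.val ≠ k.val := fun h => hik (Fin.ext h)
        have h2 : i.val < k.val + 1 ↔ i.val < k.val := by omega
        simp [hybridPoint, hik, h2]

/-- Exchanging the first `k` coordinates of `p` and `q` is an involution of the pairs, so hybrid
points are equidistributed in the cube. -/
theorem sum_sum_hybridPoint (F : (Fin d → ℤ) → ℝ) (a : Fin d → ℤ) (N k : ℕ) :
    ∑ p ∈ latticeBox a N, ∑ q ∈ latticeBox a N, F (hybridPoint k p q)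
      = (N : ℝ) ^ d * ∑ p ∈ latticeBox a N, F p := by
  have h : ∑ p ∈ latticeBox a N, ∑ q ∈ latticeBox a N, F (hybridPoint k p q)
      = ∑ p ∈ latticeBox a N, ∑ _q ∈ latticeBox a N, F p := by
    rw [← Finset.sum_product', ← Finset.sum_product']
    have hmem : ∀ x ∈ latticeBox a N ×ˢ latticeBox a N,
        (hybridPoint k x.1 x.2, hybridPoint k x.2 x.1) ∈ latticeBox a N ×ˢ latticeBox a N := by
      intro x hx
      rw [Finset.mem_product] at *
      exact ⟨hybridPoint_mem_latticeBox k hx.1 hx.2, hybridPoint_mem_latticeBox k hx.2 hx.1⟩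
    have hinv : ∀ x ∈ latticeBox a N ×ˢ latticeBox a N,
        (hybridPoint k (hybridPoint k x.1 x.2) (hybridPoint k x.2 x.1),
          hybridPoint k (hybridPoint k x.2 x.1) (hybridPoint k x.1 x.2)) = x := by
      intro x _
      rw [hybridPoint_hybridPoint, hybridPoint_hybridPoint]
    exact Finset.sum_nbij' (fun x => (hybridPoint k x.1 x.2, hybridPoint k x.2 x.1))
      (fun x => (hybridPoint k x.1 x.2, hybridPoint k x.2 x.1)) hmem hmem hinv hinv
      fun x _ => rfl
  rw [h, Finset.mul_sum]
  refine Finset.sum_congr rfl fun p _ => ?_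
  rw [Finset.sum_const, card_latticeBox, nsmul_eq_mul, Nat.cast_pow]

/-- Exchanging `u` with `p k` is an involution. -/
theorem sum_sum_update (F : (Fin d → ℤ) → ℝ) (a : Fin d → ℤ) (N : ℕ) (k : Fin d) :
    ∑ p ∈ latticeBox a N, ∑ u ∈ Finset.Ico (a k) (a k + N), F (Function.update p k u)
      = N * ∑ p ∈ latticeBox a N, F p := by
  have h : ∑ p ∈ latticeBox a N, ∑ u ∈ Finset.Ico (a k) (a k + N), F (Function.update p k u)
      = ∑ p ∈ latticeBox a N, ∑ _u ∈ Finset.Ico (a k) (a k + N), F p := by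
    rw [← Finset.sum_product', ← Finset.sum_product']
    have hmem : ∀ x ∈ latticeBox a N ×ˢ Finset.Ico (a k) (a k + N),
        (Function.update x.1 k x.2, x.1 k) ∈ latticeBox a N ×ˢ Finset.Ico (a k) (a k + N) := by
      intro x hx
      rw [Finset.mem_product, mem_latticeBox] at *
      refine ⟨fun i => ?_, hx.1 k⟩
      rcases eq_or_ne i k with rfl | hik
      · simpa only [Function.update_self] using hx.2
      · simpa only [Function.update_of_ne hik] using hx.1 i
    have hinv : ∀ x ∈ latticeBox a N ×ˢ Finset.Ico (a k) (a k + N),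
        (Function.update (Function.update x.1 k x.2) k (x.1 k), Function.update x.1 k x.2 k) = x := by
      intro x _
      simp
    exact Finset.sum_nbij' (fun x => (Function.update x.1 k x.2, x.1 k))
      (fun x => (Function.update x.1 k x.2, x.1 k)) hmem hmem hinv hinv fun x _ => rfl
  rw [h, Finset.mul_sum]
  refine Finset.sum_congr rfl fun p _ => ?_
  rw [Finset.sum_const, Int.card_Ico, nsmul_eq_mul]
  simp

theorem sum_sum_boxCost (w : (Fin d → ℤ) → ℝ) (a : Fin d → ℤ) (N : ℕ) :
    ∑ p ∈ latticeBox a N, ∑ q ∈ latticeBox a N, boxCost w a N p q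
      = 2 * d * N * ((N : ℝ) ^ d * ∑ p ∈ latticeBox a N, w p) := by
  have h : ∀ k : Fin d, ∑ p ∈ latticeBox a N, ∑ q ∈ latticeBox a N,
      ∑ u ∈ Finset.Ico (a k) (a k + N), 2 * w (Function.update (hybridPoint k p q) k u)
      = 2 * N * ((N : ℝ) ^ d * ∑ p ∈ latticeBox a N, w p) := by
    intro k
    rw [sum_sum_hybridPoint
      (fun p => ∑ u ∈ Finset.Ico (a k) (a k + N), 2 * w (Function.update p k u)) a N k,
      sum_sum_update (fun p => 2 * w p), ← Finset.mul_sum]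
    ring
  have h2 : ∑ p ∈ latticeBox a N, ∑ q ∈ latticeBox a N, boxCost w a N p q
      = ∑ k : Fin d, ∑ p ∈ latticeBox a N, ∑ q ∈ latticeBox a N,
      ∑ u ∈ Finset.Ico (a k) (a k + N), 2 * w (Function.update (hybridPoint k p q) k u) := by
    rw [Finset.sum_comm]
    simp only [boxCost]
    rw [Finset.sum_comm]
    rw [Finset.sum_congr rfl fun p _ => Finset.sum_comm, Finset.sum_comm]
  rw [h2, Finset.sum_congr rfl fun k _ => h k]
  simp
  ring

/-- Jensen's inequality for the sum of the `τ`-th powers. -/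
theorem sum_rpow_le {ι : Type*} (s : Finset ι) {l : ι → ℝ} {τ : ℝ} (hτ0 : 0 ≤ τ) (hτ1 : τ ≤ 1)
    (hl : ∀ i, 0 ≤ l i) (hsum : ∑ i ∈ s, l i ≤ 1) (hs : s.Nonempty) :
    ∑ i ∈ s, l i ^ τ ≤ (s.card : ℝ) * (s.card : ℝ) ^ (-τ) := by
  have hc : (0 : ℝ) < s.card := by exact_mod_cast hs.card_pos
  have h := (Real.concaveOn_rpow hτ0 hτ1).le_map_sum (t := s) (w := fun _ => (s.card : ℝ)⁻¹) (p := l)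
    (fun i _ => by positivity) (by simp [hc.ne']) (fun i _ => hl i)
  simp only [smul_eq_mul, ← Finset.mul_sum] at h
  rw [inv_mul_le_iff₀ hc] at h
  refine h.trans (mul_le_mul_of_nonneg_left ?_ hc.le)
  rw [Real.rpow_neg hc.le, ← Real.inv_rpow hc.le]
  refine Real.rpow_le_rpow (mul_nonneg (by positivity) (Finset.sum_nonneg fun i _ => hl i)) ?_ hτ0
  exact mul_le_of_le_one_right (by positivity) hsum

/-- The average cost over pairs is `2 * d * N` times the average of `l ^ τ`, and Jensen bounds the
latter by `N ^ (-d * τ)`. For `τ > 1 / d` the result decays geometrically along dyadic `N`. -/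
theorem sum_sum_boxCost_le {l : (Fin d → ℤ) → ℝ} {τ : ℝ} (hτ0 : 0 ≤ τ) (hτ1 : τ ≤ 1)
    (hl : ∀ i, 0 ≤ l i) (hsum : ∀ s : Finset (Fin d → ℤ), ∑ i ∈ s, l i ≤ 1)
    (a : Fin d → ℤ) {N : ℕ} (hN : 0 < N) :
    ∑ p ∈ latticeBox a N, ∑ q ∈ latticeBox a N, boxCost (fun x => l x ^ τ) a N p q
      ≤ (N : ℝ) ^ d * (N : ℝ) ^ d * (2 * d * (N : ℝ) ^ (1 - d * τ)) := by
  have hN' : (0 : ℝ) < N := by exact_mod_cast hN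
  have hne : (latticeBox a N).Nonempty := by
    rw [← Finset.card_pos, card_latticeBox]
    positivity
  have h := sum_rpow_le (latticeBox a N) hτ0 hτ1 hl (hsum _) hne
  rw [card_latticeBox, Nat.cast_pow] at h
  have h2 : ((N : ℝ) ^ d) ^ (-τ) * N = (N : ℝ) ^ (1 - d * τ) := by
    rw [← Real.rpow_natCast, ← Real.rpow_mul hN'.le]
    nth_rw 2 [← Real.rpow_one (N : ℝ)]
    rw [← Real.rpow_add hN']
    congr 1
    ring
  rw [sum_sum_boxCost, ← h2]
  calc _ ≤ 2 * d * N * ((N : ℝ) ^ d * ((N : ℝ) ^ d * ((N : ℝ) ^ d) ^ (-τ))) := by gcongr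
    _ = _ := by ring

/-- Averaging: walks of bounded average cost from `x` to the points of `B`, and from the points
of `B` to those of `B'`, give walks of bounded average cost from `x` to the points of `B'`. -/
theorem exists_hasWalk_of_average {w : (Fin d → ℤ) → ℝ} {x : Fin d → ℤ}
    {B B' : Finset (Fin d → ℤ)} (hB : B.Nonempty) {A : (Fin d → ℤ) → ℝ}
    {R : (Fin d → ℤ) → (Fin d → ℤ) → ℝ} {S ρ : ℝ} (hA : ∀ p ∈ B, HasWalk w x p (A p))
    (hAS : ∑ p ∈ B, A p ≤ B.card * S) (hR : ∀ p ∈ B, ∀ q ∈ B', HasWalk w p q (R p q))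
    (hRρ : ∑ p ∈ B, ∑ q ∈ B', R p q ≤ B.card * B'.card * ρ) :
    ∃ A' : (Fin d → ℤ) → ℝ, (∀ q ∈ B', HasWalk w x q (A' q)) ∧
      ∑ q ∈ B', A' q ≤ B'.card * (S + ρ) := by
  have hc : (0 : ℝ) < B.card := by exact_mod_cast hB.card_pos
  refine ⟨fun q => (B.card : ℝ)⁻¹ * ∑ p ∈ B, (A p + R p q), fun q hq => ?_, ?_⟩
  -- For each `q`, some intermediate point `p` does no worse than the average over `B`.
  · obtain ⟨p, hp, hle⟩ := Finset.exists_le_of_sum_le (s := B) hB (f := fun p => A p + R p q)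
      (g := fun _ => (B.card : ℝ)⁻¹ * ∑ p ∈ B, (A p + R p q)) (by
        rw [Finset.sum_const, nsmul_eq_mul, mul_inv_cancel_left₀ hc.ne'])
    exact ((hA p hp).trans (hR p hp q hq)).mono hle
  · rw [← Finset.mul_sum, inv_mul_le_iff₀ hc, Finset.sum_comm]
    simp only [Finset.sum_add_distrib, Finset.sum_const, nsmul_eq_mul, ← Finset.mul_sum]
    have := mul_le_mul_of_nonneg_left hAS (Nat.cast_nonneg (α := ℝ) B'.card)
    linarith

/-- Each subset fills at least a fraction `2 ^ (-d)` of the cube, so averaging over pairs from them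
costs at most a factor `4 ^ d`. -/
theorem sum_sum_boxCost_le_of_subset {l : (Fin d → ℤ) → ℝ} {τ : ℝ} (hτ0 : 0 ≤ τ) (hτ1 : τ ≤ 1)
    (hl : ∀ i, 0 ≤ l i) (hsum : ∀ s : Finset (Fin d → ℤ), ∑ i ∈ s, l i ≤ 1)
    {a : Fin d → ℤ} {N : ℕ} (hN : 0 < N) {B B' : Finset (Fin d → ℤ)} (hB : B ⊆ latticeBox a N)
    (hB' : B' ⊆ latticeBox a N) (hc : N ^ d ≤ 2 ^ d * B.card) (hc' : N ^ d ≤ 2 ^ d * B'.card) :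
    ∑ p ∈ B, ∑ q ∈ B', boxCost (fun x => l x ^ τ) a N p q
      ≤ B.card * B'.card * (4 ^ d * (2 * d) * (N : ℝ) ^ (1 - d * τ)) := by
  have hw : ∀ x, 0 ≤ l x ^ τ := fun x => Real.rpow_nonneg (hl x) τ
  have hc1 : (N : ℝ) ^ d ≤ 2 ^ d * B.card := by exact_mod_cast hc
  have hc2 : (N : ℝ) ^ d ≤ 2 ^ d * B'.card := by exact_mod_cast hc'
  calc ∑ p ∈ B, ∑ q ∈ B', boxCost (fun x => l x ^ τ) a N p q
      ≤ ∑ p ∈ latticeBox a N, ∑ q ∈ latticeBox a N, boxCost (fun x => l x ^ τ) a N p q := by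
        refine (Finset.sum_le_sum_of_subset_of_nonneg hB fun p _ _ =>
          Finset.sum_nonneg fun q _ => boxCost_nonneg hw _ _ _ _).trans
          (Finset.sum_le_sum fun p _ => ?_)
        exact Finset.sum_le_sum_of_subset_of_nonneg hB' fun q _ _ => boxCost_nonneg hw _ _ _ _
    _ ≤ (N : ℝ) ^ d * (N : ℝ) ^ d * (2 * d * (N : ℝ) ^ (1 - d * τ)) :=
        sum_sum_boxCost_le hτ0 hτ1 hl hsum a hN
    _ ≤ (2 ^ d * B.card) * (2 ^ d * B'.card) * (2 * d * (N : ℝ) ^ (1 - d * τ)) := by gcongr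
    _ = _ := by
        rw [show (4 : ℝ) = 2 * 2 by norm_num, mul_pow]
        ring

theorem latticeBox_zero_pow (a : Fin d → ℤ) : latticeBox a (2 ^ 0) = {a} := by
  ext p
  simp only [mem_latticeBox, Finset.mem_Ico, Finset.mem_singleton, funext_iff]
  exact forall_congr' fun i => by push_cast; omega

theorem latticeBox_nonempty (a : Fin d → ℤ) (k : ℕ) : (latticeBox a (2 ^ k)).Nonempty := by
  rw [← Finset.card_pos, card_latticeBox]
  positivity

theorem latticeBox_subset {a b : Fin d → ℤ} {M N : ℕ} (h : ∀ i, b i ≤ a i ∧ a i + M ≤ b i + N) :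
    latticeBox a M ⊆ latticeBox b N := by
  intro p hp
  rw [mem_latticeBox] at *
  intro i
  have h1 := hp i
  have h2 := h i
  rw [Finset.mem_Ico] at *
  omega

/-- Walks from the corner of a dyadic cube to its points, of uniformly bounded average cost. -/
theorem exists_hasWalk_latticeBox {l : (Fin d → ℤ) → ℝ} {τ : ℝ} (hτ0 : 0 ≤ τ) (hτ1 : τ ≤ 1)
    (hl : ∀ i, 0 ≤ l i) (hsum : ∀ s : Finset (Fin d → ℤ), ∑ i ∈ s, l i ≤ 1)
    (x : Fin d → ℤ) (k : ℕ) :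
    ∃ A : (Fin d → ℤ) → ℝ, (∀ p ∈ latticeBox x (2 ^ k), HasWalk (fun y => l y ^ τ) x p (A p)) ∧
      ∑ p ∈ latticeBox x (2 ^ k), A p ≤ (latticeBox x (2 ^ k)).card *
        ∑ i ∈ Finset.range k, 4 ^ d * (2 * d) * ((2 : ℝ) ^ (1 - d * τ)) ^ (i + 1) := by
  induction k with
  | zero =>
    refine ⟨fun _ => 0, fun p hp => ?_, by simp⟩
    rw [latticeBox_zero_pow, Finset.mem_singleton] at hp
    rw [hp]
    exact HasWalk.refl le_rfl
  | succ k ih =>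
    obtain ⟨A, hA, hAS⟩ := ih
    have hw : ∀ x, 0 ≤ l x ^ τ := fun x => Real.rpow_nonneg (hl x) τ
    have hsub : latticeBox x (2 ^ k) ⊆ latticeBox x (2 ^ (k + 1)) :=
      latticeBox_subset fun i => ⟨le_rfl, by
        have : 2 ^ k ≤ 2 ^ (k + 1) := Nat.pow_le_pow_right two_pos (Nat.le_succ k)
        have : ((2 ^ k : ℕ) : ℤ) ≤ (2 ^ (k + 1) : ℕ) := by exact_mod_cast this
        linarith⟩
    rw [Finset.sum_range_succ]
    refine exists_hasWalk_of_average (latticeBox_nonempty x k) hA hAS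
      (R := boxCost (fun y => l y ^ τ) x (2 ^ (k + 1)))
      (fun p hp q hq => hasWalk_boxCost hw (hsub hp) hq) ?_
    have h := sum_sum_boxCost_le_of_subset hτ0 hτ1 hl hsum (a := x) (N := 2 ^ (k + 1))
      (by positivity) hsub (Finset.Subset.refl _)
      (by rw [card_latticeBox, ← mul_pow, pow_succ, mul_comm])
      (by rw [card_latticeBox]; exact Nat.le_mul_of_pos_left _ (by positivity))
    refine h.trans (le_of_eq ?_)
    congr 2
    push_cast
    rw [← Real.rpow_natCast, ← Real.rpow_natCast, ← Real.rpow_mul zero_le_two,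
      ← Real.rpow_mul zero_le_two, mul_comm]

/-- For a nonnegative function on `ℤᵈ` of total mass at most one, and `τ > 1 / d`, every point
can be reached from the origin along a walk with a uniformly bounded sum of `τ`-th powers. -/
theorem exists_uniform_hasWalk {τ : ℝ} (hd : 0 < d) (hτ : 1 / (d : ℝ) < τ) (hτ1 : τ ≤ 1) :
    ∃ S : ℝ, ∀ l : (Fin d → ℤ) → ℝ, (∀ i, 0 ≤ l i) →
      (∀ s : Finset (Fin d → ℤ), ∑ i ∈ s, l i ≤ 1) →
      ∀ v, HasWalk (fun y => l y ^ τ) 0 v S := by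
  have hd' : (0 : ℝ) < d := by exact_mod_cast hd
  have hτ0 : 0 ≤ τ := le_trans (by positivity) hτ.le
  have hexp : 1 - d * τ < 0 := by
    rw [div_lt_iff₀ hd'] at hτ
    linarith
  set r : ℝ := (2 : ℝ) ^ (1 - d * τ) with hr
  have hr0 : 0 ≤ r := by positivity
  have hr1 : r < 1 := Real.rpow_lt_one_of_one_lt_of_neg one_lt_two hexp
  set M : ℝ := 4 ^ d * (2 * d) with hM
  have hM0 : 0 ≤ M := by positivity
  have hgeom : ∀ k, ∑ i ∈ Finset.range k, M * r ^ (i + 1) ≤ M * (1 - r)⁻¹ := fun k => by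
    rw [← Finset.mul_sum, ← tsum_geometric_of_lt_one hr0 hr1]
    refine mul_le_mul_of_nonneg_left ?_ hM0
    refine le_trans (Finset.sum_le_sum fun i _ => pow_le_pow_of_le_one hr0 hr1.le (Nat.le_succ i)) ?_
    exact (summable_geometric_of_lt_one hr0 hr1).sum_le_tsum _ fun i _ => pow_nonneg hr0 i
  -- The three terms pay for going from `0` into its cube, crossing to the cube of `v`, and
  -- descending to `v` by reversed walks.
  refine ⟨M * (1 - r)⁻¹ + M + M * (1 - r)⁻¹, fun l hl hsum v => ?_⟩
  have hw : ∀ x, 0 ≤ l x ^ τ := fun x => Real.rpow_nonneg (hl x) τ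
  obtain ⟨K, hK⟩ : ∃ K : ℕ, ∀ i, |v i| ≤ 2 ^ K := by
    refine ⟨(∑ i, |v i|).toNat, fun i => ?_⟩
    have h1 : |v i| ≤ ∑ i, |v i| := Finset.single_le_sum (f := fun i => |v i|)
      (fun _ _ => abs_nonneg _) (Finset.mem_univ i)
    have h2 : (∑ i, |v i|).toNat < 2 ^ (∑ i, |v i|).toNat := Nat.lt_two_pow_self
    have h3 : ((∑ i, |v i|).toNat : ℤ) < 2 ^ (∑ i, |v i|).toNat := by exact_mod_cast h2
    omega
  obtain ⟨A, hA, hAS⟩ := exists_hasWalk_latticeBox hτ0 hτ1 hl hsum 0 K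
  obtain ⟨A', hA', hAS'⟩ := exists_hasWalk_latticeBox hτ0 hτ1 hl hsum v K
  have hcard : (2 ^ (K + 1)) ^ d = 2 ^ d * (2 ^ K) ^ d := by rw [← mul_pow, pow_succ, mul_comm]
  -- Since `|v i| ≤ 2 ^ K`, the cube of side `2 ^ (K + 1)` at `a` contains both cubes of side `2 ^
  -- K`.
  set a : Fin d → ℤ := fun i => min 0 (v i) with ha
  have hsub : latticeBox 0 (2 ^ K) ⊆ latticeBox a (2 ^ (K + 1)) := latticeBox_subset fun i => by
    have := abs_le.mp (hK i)
    simp only [ha, Pi.zero_apply]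
    push_cast
    rw [pow_succ]
    generalize (2 : ℤ) ^ K = t at *
    omega
  have hsub' : latticeBox v (2 ^ K) ⊆ latticeBox a (2 ^ (K + 1)) := latticeBox_subset fun i => by
    have := abs_le.mp (hK i)
    simp only [ha]
    push_cast
    rw [pow_succ]
    generalize (2 : ℤ) ^ K = t at *
    omega
  obtain ⟨A₁, hA₁, hAS₁⟩ := exists_hasWalk_of_average (S := M * (1 - r)⁻¹) (ρ := M)
    (B' := latticeBox v (2 ^ K)) (latticeBox_nonempty 0 K) hA
    (hAS.trans (mul_le_mul_of_nonneg_left (hgeom K) (Nat.cast_nonneg _)))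
    (R := boxCost (fun y => l y ^ τ) a (2 ^ (K + 1)))
    (fun p hp q hq => hasWalk_boxCost hw (hsub hp) (hsub' hq)) (by
      refine (sum_sum_boxCost_le_of_subset hτ0 hτ1 hl hsum (a := a) (N := 2 ^ (K + 1))
        (by positivity) hsub hsub' (by rw [card_latticeBox, hcard])
        (by rw [card_latticeBox, hcard])).trans (mul_le_mul_of_nonneg_left ?_ (by positivity))
      refine mul_le_of_le_one_right hM0 (Real.rpow_le_one_of_one_le_of_nonpos ?_ hexp.le)
      exact_mod_cast Nat.one_le_two_pow)
  obtain ⟨A₂, hA₂, hAS₂⟩ := exists_hasWalk_of_average (ρ := M * (1 - r)⁻¹)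
    (B' := {v}) (latticeBox_nonempty v K) hA₁ hAS₁ (R := fun p _ => A' p)
    (fun p hp q hq => by
      rw [Finset.mem_singleton.mp hq]
      exact (hA' p hp).symm)
    (by simpa using hAS'.trans (mul_le_mul_of_nonneg_left (hgeom K) (Nat.cast_nonneg _)))
  refine (hA₂ v (Finset.mem_singleton_self v)).mono ?_
  simpa using hAS₂

end LatticeWalks

/-! ### Lengths of adjacent and of non-overlapping intervals. -/

/-- Along a walk, the ratio of the lengths of two adjacent intervals is controlled by the cost. -/
theorem HasWalk.ratio_le {d : ℕ} {len len' : (Fin d → ℤ) → ℝ} {C τ κ S c : ℝ} {x v : Fin d → ℤ}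
    (hlen : ∀ v, 0 < len v) (hlen' : ∀ v, 0 < len' v) (hC : 0 ≤ C) (hτ : 0 ≤ τ)
    (hstep : ∀ y z, LatticeAdj y z →
      len' z * len y ≤ Real.exp (C * (len y + len' y) ^ τ) * (len z * len' y))
    (h0 : len' x ≤ κ * len x) (hκ : κ * Real.exp (C * 2 ^ τ * S) ≤ 1)
    (h : HasWalk (fun v => len v ^ τ) x v c) (hc : c ≤ S) :
    len' v ≤ κ * Real.exp (C * 2 ^ τ * c) * len v := by
  have hκ0 : 0 < κ := pos_of_mul_pos_left ((hlen' x).trans_le h0) (hlen x).le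
  have hD : 0 ≤ C * 2 ^ τ := by positivity
  induction h with
  | @refl c hc0 =>
    refine h0.trans (mul_le_mul_of_nonneg_right ?_ (hlen x).le)
    exact le_mul_of_one_le_right hκ0.le (Real.one_le_exp (mul_nonneg hD hc0))
  | @step y z c c' _ hyz hcc ih =>
    have hy := Real.rpow_nonneg (hlen y).le τ
    have hz := Real.rpow_nonneg (hlen z).le τ
    have hcS : c ≤ S := by linarith
    have ih' := ih hcS
    -- Bootstrap: the ratio bound so far keeps `len'` below `len`, so the next distortion involves
    -- only `len y`, up to the factor `2 ^ τ`.
    have hle : len' y ≤ len y := by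
      refine ih'.trans (mul_le_of_le_one_left (hlen y).le (le_trans ?_ hκ))
      gcongr
    have hpow : (len y + len' y) ^ τ ≤ 2 ^ τ * len y ^ τ := by
      rw [← Real.mul_rpow zero_le_two (hlen y).le]
      have := hlen y
      have := hlen' y
      gcongr
      linarith
    have hly := hlen y
    have hlz := hlen z
    have h1 : len' z * len y ≤ Real.exp (C * (2 ^ τ * len y ^ τ)) *
        (len z * (κ * Real.exp (C * 2 ^ τ * c) * len y)) := by
      refine (hstep y z hyz).trans ?_
      have := hlen' y
      gcongr
    have h2 : Real.exp (C * (2 ^ τ * len y ^ τ)) * (len z * (κ * Real.exp (C * 2 ^ τ * c) * len y))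
        = κ * Real.exp (C * 2 ^ τ * (c + len y ^ τ)) * len z * len y := by
      rw [mul_add (C * 2 ^ τ), Real.exp_add, ← mul_assoc C]
      ring
    rw [h2] at h1
    refine (le_of_mul_le_mul_right h1 hly).trans ?_
    gcongr
    linarith

/-- Non-overlapping subintervals of `[0,1]` have total length at most one. -/
theorem sum_length_le_one {ι : Type*} {a b : ι → ℝ} (ha : ∀ i, 0 ≤ a i) (hb : ∀ i, b i ≤ 1)
    (hab : ∀ i, a i ≤ b i) (hdisj : ∀ i j, i ≠ j → b i ≤ a j ∨ b j ≤ a i) (s : Finset ι) :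
    ∑ i ∈ s, (b i - a i) ≤ 1 := by
  have h1 : MeasureTheory.volume (⋃ i ∈ s, Set.Ioo (a i) (b i))
      = ∑ i ∈ s, ENNReal.ofReal (b i - a i) := by
    rw [MeasureTheory.measure_biUnion_finset _ fun i _ => measurableSet_Ioo]
    · simp only [Real.volume_Ioo]
    · intro i _ j _ hij
      rw [Function.onFun, Set.disjoint_left]
      intro x hx hx'
      rcases hdisj i j hij with h | h
      · exact absurd (hx.2.trans_le h) (not_lt.mpr hx'.1.le)
      · exact absurd (hx'.2.trans_le h) (not_lt.mpr hx.1.le)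
  have h2 : MeasureTheory.volume (⋃ i ∈ s, Set.Ioo (a i) (b i))
      ≤ MeasureTheory.volume (Set.Icc (0 : ℝ) 1) := by
    refine MeasureTheory.measure_mono (Set.iUnion₂_subset fun i _ x hx => ?_)
    exact ⟨(ha i).trans hx.1.le, hx.2.le.trans (hb i)⟩
  rw [h1, ← ENNReal.ofReal_sum_of_nonneg fun i _ => sub_nonneg.mpr (hab i), Real.volume_Icc] at h2
  simpa using (ENNReal.ofReal_le_ofReal_iff (by norm_num)).mp h2

/-! ### Distortion of diffeomorphisms and exclusion of wandering intervals. -/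

namespace HomeoPlus

theorem strictMono_smul (Γ : Subgroup HomeoPlus) (g : Γ) :
    StrictMono fun x : Set.Ioo (0 : I) 1 => g • x :=
  fun _ _ h => g.1.2 h

theorem toReal_coe (f : HomeoPlus) (x : I) : toReal f x = f.1 x :=
  Set.IccExtend_val _ _ x

/-- The ratio of the lengths of two adjacent intervals is distorted by a bounded amount. -/
theorem IsDiffeoHolder.exists_distortion_le {τ : ℝ} (hτ : 0 ≤ τ) {f : HomeoPlus}
    (hf : IsDiffeoHolder τ f) :
    ∃ C : ℝ, 0 ≤ C ∧ ∀ s m t : I, s < m → m < t →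
      ((f.1 t : ℝ) - f.1 m) * (m - s)
        ≤ Real.exp (C * ((t : ℝ) - s) ^ τ) * (((f.1 m : ℝ) - f.1 s) * (t - m)) := by
  obtain ⟨H, hH⟩ := hf.holder
  have hu : UniqueDiffOn ℝ (Set.Icc (0 : ℝ) 1) := uniqueDiffOn_Icc zero_lt_one
  obtain ⟨M, hM⟩ := isCompact_Icc.exists_bound_of_continuousOn
    (hf.contDiffOn_inv.continuousOn_derivWithin hu le_rfl)
  have hM0 : 0 ≤ M := (norm_nonneg _).trans (hM 0 ⟨le_rfl, zero_le_one⟩)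
  have hlip : ∀ s m : I, s < m → (m : ℝ) - s ≤ M * ((f.1 m : ℝ) - f.1 s) := by
    intro s m hsm
    have h := Convex.norm_image_sub_le_of_norm_derivWithin_le
      (hf.contDiffOn_inv.differentiableOn one_ne_zero) hM (convex_Icc 0 1) (f.1 s).2 (f.1 m).2
    have hinv : ∀ x : I, toReal f⁻¹ (f.1 x) = x := fun x => by
      rw [toReal_coe]
      exact congrArg _ (f.1.symm_apply_apply x)
    rw [hinv, hinv, Real.norm_eq_abs, Real.norm_eq_abs, abs_of_pos (sub_pos.mpr (show (s : ℝ) < m from hsm)),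
      abs_of_pos (sub_pos.mpr (show (f.1 s : ℝ) < f.1 m from f.2 hsm))] at h
    exact h
  have hslope : ∀ s m : I, s < m → ∃ ξ : ℝ, (s : ℝ) < ξ ∧ ξ < m ∧
      (f.1 m : ℝ) - f.1 s = derivWithin (toReal f) (Set.Icc 0 1) ξ * (m - s) := by
    intro s m hsm
    have hsm' : (s : ℝ) < m := hsm
    have hsub : Set.Icc (s : ℝ) m ⊆ Set.Icc 0 1 := Set.Icc_subset_Icc s.2.1 m.2.2
    obtain ⟨ξ, hξ, h⟩ := exists_hasDerivAt_eq_slope (toReal f) (derivWithin (toReal f) (Set.Icc 0 1))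
      hsm' (hf.contDiffOn.continuousOn.mono hsub) fun x hx =>
        ((hf.contDiffOn.differentiableOn one_ne_zero x (hsub (Set.Ioo_subset_Icc_self hx))
          ).hasDerivWithinAt).hasDerivAt
          (Icc_mem_nhds (s.2.1.trans_lt hx.1) (hx.2.trans_le m.2.2))
    refine ⟨ξ, hξ.1, hξ.2, ?_⟩
    rw [h, toReal_coe, toReal_coe, div_mul_cancel₀ _ (sub_pos.mpr hsm').ne']
  -- With mean slopes `A` on `[s, m]` and `B` on `[m, t]`, Hölder continuity bounds `B - A` by `|H|
  -- * (t - s) ^ τ`, and `1 ≤ M * A` makes this bound relative to `A`.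
  refine ⟨M * |H|, by positivity, fun s m t hsm hmt => ?_⟩
  obtain ⟨ξ, hsξ, hξm, hξ⟩ := hslope s m hsm
  obtain ⟨η, hmη, hηt, hη⟩ := hslope m t hmt
  have h1 := hlip s m hsm
  have hsm' : (0 : ℝ) < m - s := sub_pos.mpr hsm
  have hmt' : (0 : ℝ) < t - m := sub_pos.mpr hmt
  have hs0 := s.2.1
  have ht1 := t.2.2
  have hHol := (le_abs_self _).trans (hH η ⟨by linarith, by linarith⟩ ξ ⟨by linarith, by linarith⟩)
  set A := derivWithin (toReal f) (Set.Icc 0 1) ξ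
  set B := derivWithin (toReal f) (Set.Icc 0 1) η
  have hpow : H * |η - ξ| ^ τ ≤ |H| * ((t : ℝ) - s) ^ τ := by
    have h3 : |η - ξ| ≤ (t : ℝ) - s := by rw [abs_of_pos] <;> linarith
    gcongr
    exact le_abs_self H
  have hP : 0 ≤ |H| * ((t : ℝ) - s) ^ τ := by
    have : (0 : ℝ) ≤ t - s := by linarith
    positivity
  have hMA : 1 ≤ M * A := by
    rw [hξ, ← mul_assoc] at h1
    exact le_of_mul_le_mul_right (by linarith) hsm'
  have hA : 0 < A := pos_of_mul_pos_right (by linarith : 0 < M * A) hM0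
  have hBA : B ≤ Real.exp (M * |H| * ((t : ℝ) - s) ^ τ) * A := by
    have h4 := Real.add_one_le_exp (M * |H| * ((t : ℝ) - s) ^ τ)
    have h5 := mul_le_mul_of_nonneg_right h4 hA.le
    have h6 := mul_le_mul_of_nonneg_left hMA hP
    linarith
  rw [hη, hξ]
  calc B * (t - m) * (m - s) ≤ (Real.exp (M * |H| * ((t : ℝ) - s) ^ τ) * A) * (t - m) * (m - s) := by
        gcongr
    _ = _ := by ring

/-- In class `C^{1+τ}` with `τ > 1 / d`, a group isomorphic to `ℤᵈ` has no wandering interval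
`[x, b]` whose right endpoint is accumulated by its images. -/
theorem false_of_wandering_interval {d : ℕ} (hd : 0 < d) {τ : ℝ} (hτ : 1 / (d : ℝ) < τ)
    (hτ1 : τ ≤ 1) {Γ : Subgroup HomeoPlus} (hΓ : ∀ f ∈ Γ, IsDiffeoHolder τ f)
    (e : Γ ≃* Multiplicative (Fin d → ℤ)) {x b : Set.Ioo (0 : I) 1} (hxb : x < b)
    (hdisj : ∀ g : Γ, g ≠ 1 → b ≤ g • x ∨ b ≤ g⁻¹ • x)
    (hacc : ∀ r, b < r → ∃ g : Γ, b ≤ g • x ∧ g • b < r ∧ ∀ y : Set.Ioo (0 : I) 1, y < g • y) :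
    False := by
  have hd' : (0 : ℝ) < d := by exact_mod_cast hd
  have hτ0 : 0 ≤ τ := le_trans (by positivity) hτ.le
  obtain ⟨S, hS⟩ := exists_uniform_hasWalk hd hτ hτ1
  set E : (Fin d → ℤ) → Γ := fun v => e.symm (.ofAdd v) with hE
  have hE0 : E 0 = 1 := by simp [hE]
  have hEadd : ∀ v w, E (v + w) = E v * E w := fun v w => by simp [hE]
  have hEinj : ∀ v w, E v = E w → v = w := fun v w h => by simpa [hE] using h
  set P : (Fin d → ℤ) → Set.Ioo (0 : I) 1 → ℝ := fun v y => ((E v • y : Set.Ioo (0 : I) 1) : I)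
    with hP
  have hPmono : ∀ v, StrictMono (P v) := fun v y z hyz => strictMono_smul Γ (E v) hyz
  obtain ⟨C, hC, hstep⟩ : ∃ C : ℝ, 0 ≤ C ∧ ∀ y z, LatticeAdj y z → ∀ s m t, s < m → m < t →
      (P z t - P z m) * (P y m - P y s)
        ≤ Real.exp (C * (P y t - P y s) ^ τ) * ((P z m - P z s) * (P y t - P y m)) := by
    choose D hD0 hD using fun g : Γ => (hΓ g.1 g.2).exists_distortion_le hτ0
    set F : Fin d → Γ := fun i => E (Pi.single i 1)
    have key : ∀ C : ℝ, ∀ g : Γ, ∀ y z, D g ≤ C → E z = g * E y → ∀ s m t, s < m → m < t →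
        (P z t - P z m) * (P y m - P y s)
          ≤ Real.exp (C * (P y t - P y s) ^ τ) * ((P z m - P z s) * (P y t - P y m)) := by
      intro C g y z hg hz s m t hsm hmt
      have hPz : ∀ x, P z x = g.1.1 (E y • x : Set.Ioo (0 : I) 1) := fun x => by
        simp only [hP, hz, mul_smul]
        rfl
      have h1 := hPmono y hsm
      have h2 := hPmono y hmt
      have h3 := hPmono z hsm
      rw [hPz t, hPz m, hPz s]
      rw [hPz s, hPz m] at h3
      refine (hD g _ _ _ (strictMono_smul Γ (E y) hsm) (strictMono_smul Γ (E y) hmt)).trans ?_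
      have h4 : (0 : ℝ) ≤ P y t - P y s := by linarith
      refine mul_le_mul_of_nonneg_right (Real.exp_le_exp.mpr ?_)
        (mul_nonneg (by linarith) (sub_nonneg.mpr h2.le))
      exact mul_le_mul_of_nonneg_right hg (Real.rpow_nonneg h4 τ)
    have hC0 : ∀ i, 0 ≤ D (F i) + D (F i)⁻¹ := fun i => add_nonneg (hD0 _) (hD0 _)
    -- A step of a walk applies a generator or its inverse; one constant serves all of them.
    refine ⟨∑ i, (D (F i) + D (F i)⁻¹), Finset.sum_nonneg fun i _ => hC0 i, ?_⟩
    rintro y z ⟨i, hi⟩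
    have hle := Finset.single_le_sum (fun i _ => hC0 i) (Finset.mem_univ i)
    rcases hi with hi | hi
    · refine key _ (F i) y z (by linarith [hD0 (F i)⁻¹]) ?_
      rw [hi, add_comm, hEadd]
    · refine key _ (F i)⁻¹ y z (by linarith [hD0 (F i)]) ?_
      rw [hi, add_comm, hEadd, inv_mul_cancel_left]
  have hxb' : ((x : I) : ℝ) < (b : I) := hxb
  have hx0 : (0 : ℝ) < (x : I) := x.2.1
  have hb1 : ((b : I) : ℝ) < 1 := b.2.2
  -- An initial ratio `κ` this small stays at most 1 along every walk of cost `S`, and leaves room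
  -- for `b'` inside the interval.
  obtain ⟨κ, hκ0, hκS, hκ1⟩ : ∃ κ : ℝ, 0 < κ ∧ κ * Real.exp (C * 2 ^ τ * S) ≤ 1 ∧
      ((b : I) : ℝ) + κ * ((b : I) - (x : I)) < 1 := by
    refine ⟨min (Real.exp (-(C * 2 ^ τ * S))) (1 - (b : I)), lt_min (Real.exp_pos _) (by linarith),
      ?_, ?_⟩
    · calc _ ≤ Real.exp (-(C * 2 ^ τ * S)) * Real.exp (C * 2 ^ τ * S) := by
            gcongr
            exact min_le_left _ _
        _ = 1 := by rw [← Real.exp_add, neg_add_cancel, Real.exp_zero]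
    · have h1 : min (Real.exp (-(C * 2 ^ τ * S))) (1 - (b : I)) * (((b : I) : ℝ) - (x : I))
          ≤ (1 - (b : I)) * (((b : I) : ℝ) - (x : I)) := by
        have : (0 : ℝ) ≤ (b : I) - (x : I) := by linarith
        gcongr
        exact min_le_right _ _
      nlinarith
  have hκL : 0 < κ * (((b : I) : ℝ) - (x : I)) := mul_pos hκ0 (by linarith)
  have hpt : ∀ u : ℝ, 0 < u → u < 1 → ∃ p : Set.Ioo (0 : I) 1, ((p : I) : ℝ) = u := fun u h0 h1 =>
    ⟨⟨⟨u, h0.le, h1.le⟩, h0, h1⟩, rfl⟩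
  obtain ⟨b', hb'⟩ := hpt (((b : I) : ℝ) + κ * ((b : I) - (x : I))) (by linarith) hκ1
  -- `r` is the midpoint of `[b, b']`: if `g • x` and `g • b` lie in `[b, r]`, then `g • b'` exceeds
  -- `g • b` by at most `r - b`, so it cannot pass `b'`.
  obtain ⟨r, hr⟩ := hpt (((b : I) : ℝ) + κ * ((b : I) - (x : I)) / 2) (by linarith) (by linarith)
  have hbb' : b < b' := show ((b : I) : ℝ) < (b' : I) by linarith
  obtain ⟨g, hgx, hgr, hg⟩ := hacc r (show ((b : I) : ℝ) < (r : I) by linarith)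
  have hsum := sum_length_le_one (a := fun v => P v x) (b := fun v => P v b)
    (fun v => (E v • x).1.2.1) (fun v => (E v • b).1.2.2) (fun v => (hPmono v hxb).le) (by
      intro v w hvw
      have hne : (E v)⁻¹ * E w ≠ 1 := fun h => hvw (hEinj v w (inv_mul_eq_one.mp h))
      rcases hdisj _ hne with h | h
      · left
        have := (strictMono_smul Γ (E v)).monotone h
        simp only [smul_smul, mul_inv_cancel_left] at this
        exact this
      · right
        have := (strictMono_smul Γ (E w)).monotone h
        simp only [smul_smul, mul_inv_rev, inv_inv, mul_inv_cancel_left] at this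
        exact this)
  have hEg : E (e g).toAdd = g := by simp [hE]
  have hwalk := hS (fun v => P v b - P v x) (fun v => sub_nonneg.mpr (hPmono v hxb).le) hsum
    (e g).toAdd
  have hratio := HasWalk.ratio_le (len' := fun v => P v b' - P v b) (κ := κ) (C := C)
    (fun v => sub_pos.mpr (hPmono v hxb)) (fun v => sub_pos.mpr (hPmono v hbb')) hC hτ0
    (fun y z hyz => by
      have := hstep y z hyz x b b' hxb hbb'
      rwa [show P y b' - P y x = P y b - P y x + (P y b' - P y b) by ring] at this)
    (by
      simp only [hP, hE0, one_smul, hb']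
      linarith) hκS hwalk le_rfl
  simp only [hP, hEg] at hratio
  have hlen : (0 : ℝ) ≤ ((g • b : Set.Ioo (0 : I) 1) : I) - ((g • x : Set.Ioo (0 : I) 1) : I) :=
    sub_nonneg.mpr (strictMono_smul Γ g hxb).le
  have h1 := mul_le_mul_of_nonneg_right hκS hlen
  have h2 : ((b : I) : ℝ) ≤ ((g • x : Set.Ioo (0 : I) 1) : I) := hgx
  have h3 : (((g • b : Set.Ioo (0 : I) 1) : I) : ℝ) < (r : I) := hgr
  have h4 : ((b' : I) : ℝ) < ((g • b' : Set.Ioo (0 : I) 1) : I) := hg b'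
  linarith

end HomeoPlus

theorem mainTheorem6 (d : ℕ) (hd : 2 ≤ d) (τ : ℝ) (hτ : 1 / (d : ℝ) < τ) (hτ_le : τ ≤ 1)
    (Γ : Subgroup HomeoPlus)
    (hΓ_diff : ∀ f ∈ Γ, HomeoPlus.IsDiffeoHolder τ f)
    (hΓ_iso : Nonempty (Γ ≃* Multiplicative (Fin d → ℤ)))
    (hΓ_free : HomeoPlus.ActsFreely Γ) :
    MulAction.IsMinimal Γ (Set.Ioo (0 : I) 1) ∧ HomeoPlus.ConjugateToTranslations Γ := by
  obtain ⟨e⟩ := hΓ_iso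
  have _ : Inhabited (Set.Ioo (0 : I) 1) := Classical.inhabited_of_nonempty
    (Set.nonempty_Ioo.mpr zero_lt_one).to_subtype
  have hmono := HomeoPlus.strictMono_smul Γ
  have hcomm : ∀ g h : Γ, g * h = h * g := fun g h => e.injective (by
    rw [map_mul, map_mul, mul_comm])
  obtain ⟨T, hT⟩ := exists_translationHom hcomm hmono hΓ_free
  have hker : ∀ g, (T g).toAdd = 0 → g = 1 := fun g =>
    eq_one_of_translation_eq_zero hT hmono hΓ_free
  have hdense := denseRange_of_mulEquiv_int_pi hd e T hker
  have hmin : MulAction.IsMinimal Γ (Set.Ioo (0 : I) 1) := by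
    refine isMinimal_of_exists_smul_lt hT hmono fun x q hxq => ?_
    by_contra! hgap
    obtain ⟨b, hxb, hb, hacc⟩ := exists_wandering_interval hmono hdense hxq hgap
    refine HomeoPlus.false_of_wandering_interval (by omega) hτ hτ_le hΓ_diff e hxb
      (fun g hg => ?_) fun r hr => ?_
    -- A nontrivial `g` has nonzero translation number, so `g` or `g⁻¹` is positive and moves `x` to
    -- at least `b`.
    · rcases lt_or_gt_of_ne (mt (hker g) hg) with h | h
      · exact Or.inr (hb g⁻¹ (by rw [map_inv, toAdd_inv]; linarith))
      · exact Or.inl (hb g h)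
    · obtain ⟨g, hg, hgr⟩ := hacc r hr
      exact ⟨g, hb g hg, hgr, fun y => (hT g y).mpr hg⟩
  obtain ⟨φ, hφ⟩ := exists_homeomorph_translation hT hmono hdense hmin
  exact ⟨hmin, φ, T, hφ⟩
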